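/- Let $H$ be a complex Hilbert space and $B(H)$ the algebra of bounded linear operators on $H$. For $X\in B(H)$, or $X$ in a C*-algebra, put $|X|=(X^*X)^{1/2}$. For positive invertible $A,B\in B(H)$ let $$A\# B := A^{1/2}\,(A^{-1/2}BA^{-1/2})^{1/2}\,A^{1/2},$$ and for positive, not necessarily invertible, $A,B\in B(H)$ let $A\# B$ be the limit in the strong operator topology $$A\# B:=\operatorname{sot-}\lim_{r\to 0^+}\,(A+rI)\#(B+rI).$$ Theorem. Let $\mathcal A$ be a unital C*-algebra, let $\Phi:\mathcal A\to B(H)$ be a positive linear map, and let $N\in\mathcal A$ be normal. Then there exists a partial isometry $V\in B(H)$ such that the strong limit defining $\Phi(|N|)\# V\Phi(|N|)V^*$ exists and $$|\Phi(N)|\le \Phi(|N|)\,\#\,V\Phi(|N|)V^*.$$ -/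

import Mathlib

open Filter Topology

section

variable {H : Type*} [NormedAddCommGroup H] [InnerProductSpace ℂ H] [CompleteSpace H]

/-- A bounded operator is a partial isometry if it is isometric on the orthogonal complement
of its kernel. -/
def IsPartialIsometry (V : H →L[ℂ] H) : Prop :=
  ∀ x ∈ (LinearMap.ker (V : H →ₗ[ℂ] H))ᗮ, ‖V x‖ = ‖x‖

/-- The formula `A^{1/2} (A^{-1/2} B A^{-1/2})^{1/2} A^{1/2}` for the geometric mean of two
positive invertible operators. The powers are those of the continuous functional calculus. -/
noncomputable def invGeomMean (A B : H →L[ℂ] H) : H →L[ℂ] H :=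
  A ^ (1 / 2 : ℝ) * (A ^ (-(1 / 2) : ℝ) * B * A ^ (-(1 / 2) : ℝ)) ^ (1 / 2 : ℝ) * A ^ (1 / 2 : ℝ)

/-- `G` is the geometric mean `A # B` of the positive, possibly noninvertible, operators `A`
and `B`: the limit in the strong operator topology of `(A + r I) # (B + r I)` as `r → 0⁺`. -/
def IsGeomMean (A B G : H →L[ℂ] H) : Prop :=
  ∀ x : H, Tendsto (fun r : ℝ => invGeomMean (A + (r : ℂ) • 1) (B + (r : ℂ) • 1) x)
    (𝓝[>] 0) (𝓝 (G x))

/-- The geometric mean is unique, so `IsGeomMean A B G` says exactly that the strong limit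
exists and equals `G`. -/
theorem IsGeomMean.unique {A B G G' : H →L[ℂ] H} (h : IsGeomMean A B G)
    (h' : IsGeomMean A B G') : G = G' :=
  ContinuousLinearMap.ext fun x => tendsto_nhds_unique (h x) (h' x)

end

/-!
The absolute value `|Φ N|` is compared with a geometric mean through the maximality of the latter:
if `A`, `B` are positive, `X` is self-adjoint and the operator matrix with rows `(A, X)`, `(X, B)`
is positive, then `X ≤ A # B`. Positivity of such a matrix is used throughout in the
scalar form `2 Re ⟪X x, y⟫ ≤ ⟪A x, x⟫ + ⟪B y, y⟫` for all `x`, `y`.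

* `PositiveLinearMap.two_mul_re_inner_le_of_isStarNormal` gives
  `2 Re ⟪Φ N x, y⟫ ≤ ⟪Φ |N| x, x⟫ + ⟪Φ |N| y, y⟫`. A positive map need not be completely positive,
  but `N` generates a commutative algebra: a partition of unity on its spectrum approximates `N`
  by `∑ cᵢ Pᵢ` and, at the same time, `|N|` by `∑ |cᵢ| Pᵢ`, with all `Pᵢ ≥ 0`. For such sums the
  inequality is the sum of those for the single operators `Φ Pᵢ ≥ 0`, and `Φ` is continuous.
* `exists_isPartialIsometry_mul_eq_abs` is the polar decomposition: `V * Φ N = |Φ N|` for a partial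
  isometry `V`. Taking `V* y` for `y` turns the inequality into
  `2 Re ⟪|Φ N| x, y⟫ ≤ ⟪Φ |N| x, x⟫ + ⟪V Φ |N| V* y, y⟫`.
* `IsGeomMean.le_of_forall_re_inner_le` is the maximality. For invertible `A`, minimizing over `x`
  yields `X A⁻¹ X ≤ B`, hence `(A^{-1/2} X A^{-1/2})² ≤ A^{-1/2} B A^{-1/2}`, and operator
  monotonicity of the square root gives `X ≤ A # B`; the general case follows in the limit.
* `exists_isGeomMean` provides the strong limit. Since `G = A # B` solves `G A⁻¹ G = B`, the same
  criterion shows that `#` is monotone, so `(A + r) # (B + r)` decreases as `r → 0⁺`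
  and stays positive, and bounded monotone families of operators converge strongly.
-/

/-! ### Quadratic forms of positive operators and monotone strong limits -/

section OperatorOrder

variable {H : Type*} [NormedAddCommGroup H] [InnerProductSpace ℂ H]

/-- The operator matrix all of whose entries are a positive `P` is positive: expand
`0 ≤ ⟪P (x - y), x - y⟫`. -/
theorem two_mul_re_inner_le_of_nonneg {P : H →L[ℂ] H} (hP : 0 ≤ P) (x y : H) :
    2 * (inner ℂ (P x) y).re ≤ (inner ℂ (P x) x).re + (inner ℂ (P y) y).re := by
  have hP' := (ContinuousLinearMap.nonneg_iff_isPositive P).1 hP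
  have h : 0 ≤ (inner ℂ (P (x - y)) (x - y)).re := hP'.re_inner_nonneg_left (x - y)
  have h' : (inner ℂ (P y) x).re = (inner ℂ (P x) y).re := by
    rw [hP'.inner_left_eq_inner_right, ← inner_conj_symm, Complex.conj_re]
  simp only [map_sub, inner_sub_left, inner_sub_right, Complex.sub_re] at h
  linarith

theorem re_inner_apply_mono {S T : H →L[ℂ] H} (h : S ≤ T) (x : H) :
    (inner ℂ (S x) x).re ≤ (inner ℂ (T x) x).re := by
  have := ((ContinuousLinearMap.le_def S T).1 h).re_inner_nonneg_left x
  simpa [inner_sub_left] using this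

variable [CompleteSpace H]

/-- From `P x = √P (√P x)` and `⟪P x, x⟫ = ‖√P x‖ ^ 2`. This turns convergence of quadratic forms
into strong convergence. -/
theorem norm_apply_sq_le_of_nonneg {P : H →L[ℂ] H} (hP : 0 ≤ P) (x : H) :
    ‖P x‖ ^ 2 ≤ ‖P‖ * (inner ℂ (P x) x).re := by
  have hS : 0 ≤ CFC.sqrt P := CFC.sqrt_nonneg P
  have hSS : CFC.sqrt P * CFC.sqrt P = P := CFC.sqrt_mul_sqrt_self P
  have hPx : P x = CFC.sqrt P (CFC.sqrt P x) := by
    rw [← mul_apply_eq_comp, hSS]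
  have h1 : (inner ℂ (P x) x).re = ‖CFC.sqrt P x‖ ^ 2 := by
    rw [hPx, ((ContinuousLinearMap.nonneg_iff_isPositive _).1 hS).inner_left_eq_inner_right,
      inner_self_eq_norm_sq_to_K]
    norm_cast
  have h2 : ‖P‖ = ‖CFC.sqrt P‖ ^ 2 := by
    rw [CFC.norm_sqrt P, Real.sq_sqrt (norm_nonneg _)]
  rw [h1, h2, ← mul_pow, hPx]
  gcongr
  exact ContinuousLinearMap.le_opNorm _ _

theorem le_of_re_inner_apply_le {S T : H →L[ℂ] H} (hS : IsSelfAdjoint S) (hT : IsSelfAdjoint T)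
    (h : ∀ x, (inner ℂ (S x) x).re ≤ (inner ℂ (T x) x).re) : S ≤ T := by
  rw [ContinuousLinearMap.le_def, ContinuousLinearMap.isPositive_def']
  refine ⟨hT.sub hS, fun x => ?_⟩
  have := h x
  simpa [ContinuousLinearMap.reApplyInnerSelf, inner_sub_left] using this

/-- A family of positive operators that decreases as `r → 0⁺` converges strongly. -/
theorem exists_strong_limit_of_monotoneOn {f : ℝ → H →L[ℂ] H}
    (hf : MonotoneOn f (Set.Ioi 0)) (h0 : ∀ r, 0 < r → 0 ≤ f r) :
    ∃ G : H →L[ℂ] H, ∀ x, Tendsto (fun r => f r x) (𝓝[>] 0) (𝓝 (G x)) := by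
  have key (x : H) : ∃ y, Tendsto (fun r => f r x) (𝓝[>] 0) (𝓝 y) := by
    rw [← cauchy_map_iff_exists_tendsto]
    -- The quadratic form `q` converges by monotonicity, and it controls the increments of `f r x`.
    set q : ℝ → ℝ := fun r => (inner ℂ (f r x) x).re
    have hq : MonotoneOn q (Set.Ioi 0) := fun r hr s hs hrs => re_inner_apply_mono (hf hr hs hrs) x
    have hq0 : BddBelow (q '' Set.Ioi 0) := by
      refine ⟨0, ?_⟩
      rintro _ ⟨r, hr, rfl⟩
      simpa using re_inner_apply_mono (h0 r hr) x
    have hqc : Cauchy (map q (𝓝[>] 0)) := (hq.tendsto_nhdsGT hq0).cauchy_map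
    have hle : ∀ r s, 0 < r → r ≤ s → s < 1 →
        ‖f s x - f r x‖ ^ 2 ≤ ‖f 1‖ * |q s - q r| := by
      intro r s hr hrs hs
      have hs0 : 0 < s := hr.trans_le hrs
      have hD : 0 ≤ f s - f r := sub_nonneg.2 (hf hr hs0 hrs)
      have h1 := norm_apply_sq_le_of_nonneg hD x
      have h2 : ‖f s - f r‖ ≤ ‖f 1‖ := by
        refine CStarAlgebra.norm_le_norm_of_nonneg_of_le hD ?_
        exact (sub_le_self _ (h0 r hr)).trans (hf hs0 (Set.mem_Ioi.2 one_pos) hs.le)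
      have h3 : (inner ℂ ((f s - f r) x) x).re = q s - q r := by
        simp [q]
      rw [h3] at h1
      calc ‖f s x - f r x‖ ^ 2 ≤ ‖f s - f r‖ * (q s - q r) := h1
        _ ≤ ‖f 1‖ * |q s - q r| :=
          mul_le_mul h2 (le_abs_self _) (sub_nonneg.2 (hq hr hs0 hrs)) (norm_nonneg _)
    rw [Metric.cauchy_iff] at hqc ⊢
    refine ⟨inferInstance, fun ε hε => ?_⟩
    obtain ⟨t, ht, htε⟩ := hqc.2 (ε ^ 2 / (‖f 1‖ + 1)) (by positivity)
    have hmem : q ⁻¹' t ∩ Set.Ioo 0 1 ∈ 𝓝[>] (0 : ℝ) :=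
      inter_mem ht (Ioo_mem_nhdsGT one_pos)
    refine ⟨_, image_mem_map hmem, ?_⟩
    have hmain : ∀ r ∈ q ⁻¹' t ∩ Set.Ioo 0 1, ∀ s ∈ q ⁻¹' t ∩ Set.Ioo 0 1, r ≤ s →
        ‖f s x - f r x‖ < ε := by
      intro r hr s hs hrs
      have h1 := hle r s hr.2.1 hrs hs.2.2
      have h2 := htε _ hs.1 _ hr.1
      rw [Real.dist_eq, lt_div_iff₀ (by positivity)] at h2
      refine lt_of_pow_lt_pow_left₀ 2 hε.le ?_
      nlinarith [abs_nonneg (q s - q r)]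
    rintro _ ⟨r, hr, rfl⟩ _ ⟨s, hs, rfl⟩
    rcases le_total r s with h | h
    · rw [dist_comm, dist_eq_norm]; exact hmain r hr s hs h
    · rw [dist_eq_norm]; exact hmain s hs r hr h
  choose g hg using key
  -- Boundedness of the pointwise limit is the uniform boundedness principle.
  exact ⟨continuousLinearMapOfTendsto f (tendsto_pi_nhds.2 hg), hg⟩

end OperatorOrder

/-! ### The formula for the geometric mean in a C⋆-algebra -/

section CStarAlgebra

variable {𝒜 : Type*} [CStarAlgebra 𝒜] [PartialOrder 𝒜] [StarOrderedRing 𝒜] {A B X : 𝒜}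

theorem rpow_neg_half_mul_self (hA : IsStrictlyPositive A) :
    A ^ (-(1 / 2) : ℝ) * A ^ (-(1 / 2) : ℝ) = A ^ (-1 : ℝ) := by
  rw [← CFC.rpow_add hA.isUnit]; norm_num

theorem rpow_half_mul_rpow_neg_half (hA : IsStrictlyPositive A) :
    A ^ (1 / 2 : ℝ) * A ^ (-(1 / 2) : ℝ) = 1 := by
  rw [← CFC.rpow_add hA.isUnit]; simp [CFC.rpow_zero A hA.nonneg]

theorem rpow_neg_half_mul_rpow_half (hA : IsStrictlyPositive A) :
    A ^ (-(1 / 2) : ℝ) * A ^ (1 / 2 : ℝ) = 1 := by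
  rw [← CFC.rpow_add hA.isUnit]; simp [CFC.rpow_zero A hA.nonneg]

theorem isSelfAdjoint_rpow (A : 𝒜) (p : ℝ) : IsSelfAdjoint (A ^ p) :=
  .of_nonneg CFC.rpow_nonneg

theorem mul_rpow_neg_one (hA : IsStrictlyPositive A) : A * A ^ (-1 : ℝ) = 1 := by
  nth_rewrite 1 [← CFC.rpow_one A hA.nonneg]
  rw [← CFC.rpow_add hA.isUnit]; simp [CFC.rpow_zero A hA.nonneg]

/-- The geometric mean `G = A # B` solves the Riccati equation `G A⁻¹ G = B`. This and `le_geomMean`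
are stated in an abstract C⋆-algebra, with the formula of `invGeomMean` written out. -/
theorem geomMean_riccati (hA : IsStrictlyPositive A) (hB : 0 ≤ B) :
    (A ^ (1 / 2 : ℝ) * (A ^ (-(1 / 2) : ℝ) * B * A ^ (-(1 / 2) : ℝ)) ^ (1 / 2 : ℝ) *
        A ^ (1 / 2 : ℝ)) * A ^ (-1 : ℝ) *
      (A ^ (1 / 2 : ℝ) * (A ^ (-(1 / 2) : ℝ) * B * A ^ (-(1 / 2) : ℝ)) ^ (1 / 2 : ℝ) *
        A ^ (1 / 2 : ℝ)) = B := by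
  have hC := (isSelfAdjoint_rpow A (-(1 / 2))).conjugate_nonneg hB
  have hCC := CFC.sqrt_mul_sqrt_self _ hC
  rw [CFC.sqrt_eq_rpow] at hCC
  have h1 := rpow_half_mul_rpow_neg_half hA
  have h2 := rpow_neg_half_mul_rpow_half hA
  rw [← rpow_neg_half_mul_self hA]
  generalize A ^ (1 / 2 : ℝ) = a at *
  generalize A ^ (-(1 / 2) : ℝ) = b at *
  generalize (b * B * b) ^ (1 / 2 : ℝ) = c at *
  calc a * c * a * (b * b) * (a * c * a) = a * c * (a * b) * (b * a) * c * a := by noncomm_ring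
    _ = a * (c * c) * a := by rw [h1, h2]; noncomm_ring
    _ = (a * b) * B * (b * a) := by rw [hCC]; noncomm_ring
    _ = B := by rw [h1, h2]; simp

/-- The geometric mean is the largest subsolution of the Riccati equation: with
`Y = A^{-1/2} X A^{-1/2}` the hypothesis says `Y² ≤ A^{-1/2} B A^{-1/2}`, and
`Y ≤ |Y| = (Y²)^{1/2}`. -/
theorem le_geomMean (hA : IsStrictlyPositive A) (hX : IsSelfAdjoint X)
    (h : X * A ^ (-1 : ℝ) * X ≤ B) :
    X ≤ A ^ (1 / 2 : ℝ) * (A ^ (-(1 / 2) : ℝ) * B * A ^ (-(1 / 2) : ℝ)) ^ (1 / 2 : ℝ) *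
      A ^ (1 / 2 : ℝ) := by
  have ha := isSelfAdjoint_rpow A (1 / 2)
  have hb := isSelfAdjoint_rpow A (-(1 / 2))
  have h1 := rpow_half_mul_rpow_neg_half hA
  have h2 := rpow_neg_half_mul_rpow_half hA
  rw [← rpow_neg_half_mul_self hA] at h
  generalize A ^ (1 / 2 : ℝ) = a at *
  generalize A ^ (-(1 / 2) : ℝ) = b at *
  have hY : IsSelfAdjoint (b * X * b) := hX.conjugate_self hb
  have hYY : star (b * X * b) * (b * X * b) ≤ b * B * b := by
    rw [hY.star_eq]
    calc b * X * b * (b * X * b) = b * (X * (b * b) * X) * b := by noncomm_ring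
      _ ≤ b * B * b := hb.conjugate_le_conjugate h
  have hYc : b * X * b ≤ (b * B * b) ^ (1 / 2 : ℝ) := by
    rw [← CFC.sqrt_eq_rpow]
    refine le_trans ?_ (CFC.sqrt_le_sqrt _ _ hYY)
    have h3 := CFC.abs_sub_self (b * X * b) hY
    change b * X * b ≤ CFC.abs (b * X * b)
    rw [← sub_nonneg, h3]
    exact nsmul_nonneg (CFC.negPart_nonneg _) 2
  calc X = (a * b) * X * (b * a) := by rw [h1, h2]; simp
    _ = a * (b * X * b) * a := by noncomm_ring
    _ ≤ _ := ha.conjugate_le_conjugate hYc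

open scoped ComplexOrder in
theorem isStrictlyPositive_add_smul_one (hA : 0 ≤ A) {r : ℝ} (hr : 0 < r) :
    IsStrictlyPositive (A + (r : ℂ) • (1 : 𝒜)) := by
  refine IsStrictlyPositive.nonneg_add hA ?_
  exact isStrictlyPositive_one.smul (by exact_mod_cast hr)

theorem add_smul_one_mono (A : 𝒜) {r s : ℝ} (h : r ≤ s) :
    A + (r : ℂ) • (1 : 𝒜) ≤ A + (s : ℂ) • 1 := by
  simp only [Complex.coe_smul]
  exact add_le_add_right (smul_le_smul_of_nonneg_right h zero_le_one) A

end CStarAlgebra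

/-! ### Existence and maximality of the geometric mean of operators -/

section GeomMean

variable {H : Type*} [NormedAddCommGroup H] [InnerProductSpace ℂ H] [CompleteSpace H]
variable {A B A' B' X : H →L[ℂ] H}

theorem invGeomMean_nonneg : 0 ≤ invGeomMean A B :=
  (isSelfAdjoint_rpow A (1 / 2)).conjugate_nonneg CFC.rpow_nonneg

theorem invGeomMean_mul_rpow_neg_one_mul (hA : IsStrictlyPositive A) (hB : 0 ≤ B) :
    invGeomMean A B * A ^ (-1 : ℝ) * invGeomMean A B = B :=
  geomMean_riccati hA hB

theorem le_invGeomMean (hA : IsStrictlyPositive A) (hX : IsSelfAdjoint X)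
    (h : X * A ^ (-1 : ℝ) * X ≤ B) : X ≤ invGeomMean A B :=
  le_geomMean hA hX h

/-- Monotonicity: inversion is antitone, so `G = A # B` satisfies `G A'⁻¹ G ≤ G A⁻¹ G = B ≤ B'`. -/
theorem invGeomMean_mono (hA : IsStrictlyPositive A) (hAA' : A ≤ A') (hB : 0 ≤ B) (hBB' : B ≤ B') :
    invGeomMean A B ≤ invGeomMean A' B' := by
  have hG : IsSelfAdjoint (invGeomMean A B) := (invGeomMean_nonneg).isSelfAdjoint
  refine le_invGeomMean (hA.of_le hAA') hG ?_
  calc _ ≤ invGeomMean A B * A ^ (-1 : ℝ) * invGeomMean A B :=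
        hG.conjugate_le_conjugate (CStarAlgebra.rpow_neg_one_le_rpow_neg_one hAA')
    _ = B := invGeomMean_mul_rpow_neg_one_mul hA hB
    _ ≤ B' := hBB'

theorem exists_isGeomMean (hA : 0 ≤ A) (hB : 0 ≤ B) : ∃ G, IsGeomMean A B G := by
  refine exists_strong_limit_of_monotoneOn (fun r hr s hs hrs => ?_) fun r hr => ?_
  · exact invGeomMean_mono (isStrictlyPositive_add_smul_one hA hr) (add_smul_one_mono _ hrs)
      (isStrictlyPositive_add_smul_one hB hr).nonneg (add_smul_one_mono _ hrs)
  · exact invGeomMean_nonneg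

/-- Maximality of the geometric mean for invertible `A`: the quadratic form
`⟪A x, x⟫ - 2 Re ⟪X x, y⟫` is minimal at `x = A⁻¹ X y`. -/
theorem le_invGeomMean_of_forall_re_inner_le (hA : IsStrictlyPositive A) (hB : 0 ≤ B)
    (hX : IsSelfAdjoint X)
    (h : ∀ x y, 2 * (inner ℂ (X x) y).re ≤ (inner ℂ (A x) x).re + (inner ℂ (B y) y).re) :
    X ≤ invGeomMean A B := by
  refine le_invGeomMean hA hX (le_of_re_inner_apply_le ?_ hB.isSelfAdjoint fun y => ?_)
  · exact (isSelfAdjoint_rpow A (-1)).conjugate_self hX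
  have hAx : A ((A ^ (-1 : ℝ)) (X y)) = X y :=
    DFunLike.congr_fun (mul_rpow_neg_one hA) (X y)
  have hXs := ContinuousLinearMap.isSelfAdjoint_iff_isSymmetric.1 hX
  have hq := h ((A ^ (-1 : ℝ)) (X y)) y
  have e1 : (inner ℂ ((X * A ^ (-1 : ℝ) * X) y) y).re
      = (inner ℂ (X ((A ^ (-1 : ℝ)) (X y))) y).re := rfl
  have e2 : inner ℂ (X ((A ^ (-1 : ℝ)) (X y))) y = inner ℂ ((A ^ (-1 : ℝ)) (X y)) (X y) :=
    hXs _ _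
  have e3 : (inner ℂ (X y) ((A ^ (-1 : ℝ)) (X y))).re
      = (inner ℂ ((A ^ (-1 : ℝ)) (X y)) (X y)).re := by
    rw [← inner_conj_symm, Complex.conj_re]
  rw [hAx, e2, e3] at hq
  rw [e1, e2]
  linarith

open scoped ComplexOrder in
/-- Maximality of the geometric mean: if the operator matrix with rows `(A, X)` and `(X, B)` is
positive, then `X ≤ A # B`. -/
theorem IsGeomMean.le_of_forall_re_inner_le {G : H →L[ℂ] H} (hG : IsGeomMean A B G)
    (hA : 0 ≤ A) (hB : 0 ≤ B) (hX : IsSelfAdjoint X)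
    (h : ∀ x y, 2 * (inner ℂ (X x) y).re ≤ (inner ℂ (A x) x).re + (inner ℂ (B y) y).re) :
    X ≤ G := by
  have hr : ∀ r : ℝ, 0 < r → X ≤ invGeomMean (A + (r : ℂ) • 1) (B + (r : ℂ) • 1) := by
    intro r hr
    refine le_invGeomMean_of_forall_re_inner_le (isStrictlyPositive_add_smul_one hA hr)
      (isStrictlyPositive_add_smul_one hB hr).nonneg hX fun x y => (h x y).trans ?_
    have hA' : A ≤ A + (r : ℂ) • 1 := by simpa using add_smul_one_mono A hr.le
    have hB' : B ≤ B + (r : ℂ) • 1 := by simpa using add_smul_one_mono B hr.le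
    exact add_le_add (re_inner_apply_mono hA' x) (re_inner_apply_mono hB' y)
  rw [ContinuousLinearMap.le_def, ContinuousLinearMap.isPositive_iff_complex]
  intro x
  have ht : Tendsto (fun r : ℝ =>
      inner ℂ ((invGeomMean (A + (r : ℂ) • 1) (B + (r : ℂ) • 1) - X : H →L[ℂ] H) x) x) (𝓝[>] 0)
      (𝓝 (inner ℂ ((G - X) x) x)) :=
    ((hG x).sub_const (X x)).inner tendsto_const_nhds
  have h0 : 0 ≤ inner ℂ ((G - X) x) x := by
    refine ge_of_tendsto ht (eventually_nhdsWithin_of_forall fun r hr' => ?_)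
    exact ((ContinuousLinearMap.le_def _ _).1 (hr r hr')).inner_nonneg_left x
  have h1 := Complex.nonneg_iff.1 h0
  exact ⟨Complex.ext rfl h1.2, h1.1⟩

end GeomMean

/-! ### Approximation of normal elements by combinations of positive elements -/

section Partition

open scoped ComplexOrder in
/-- Simultaneous approximation of `f` and `‖f‖` by a partition of unity `ρ`, whose coefficients for
`‖f‖` are the absolute values of those for `f`. -/
theorem exists_nonneg_combination_approx {X : Type*} [TopologicalSpace X] [CompactSpace X]
    [T2Space X] (f : C(X, ℂ)) {ε : ℝ} (hε : 0 < ε) :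
    ∃ (t : Finset X) (ρ : X → C(X, ℂ)) (c : X → ℂ), (∀ i, 0 ≤ ρ i) ∧
      (∀ x, ‖f x - ∑ i ∈ t, c i * ρ i x‖ ≤ ε) ∧
      ∀ x, ‖(‖f x‖ : ℂ) - ∑ i ∈ t, (‖c i‖ : ℂ) * ρ i x‖ ≤ ε := by
  let U : X → Set X := fun i => f ⁻¹' Metric.ball (f i) ε
  have hUo : ∀ i, IsOpen (U i) := fun i => Metric.isOpen_ball.preimage f.continuous
  have hUm : ∀ i, i ∈ U i := fun i => Metric.mem_ball_self hε
  obtain ⟨t, ht⟩ := isCompact_univ.elim_finite_subcover U hUo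
    fun x _ => Set.mem_iUnion.2 ⟨x, hUm x⟩
  obtain ⟨p, hp⟩ := PartitionOfUnity.exists_isSubordinate (s := (Set.univ : Set X)) isClosed_univ
    (fun i : t => U i) (fun i => hUo i) fun x hx => by simpa using ht hx
  classical
  -- The partition of unity is indexed by `t`; it is extended by zero to all points of `X`.
  let ρ : X → C(X, ℂ) := fun i =>
    if h : i ∈ t then ⟨fun x => (p ⟨i, h⟩ x : ℂ), by fun_prop⟩ else 0
  have hρ : ∀ i : t, ∀ x, ρ i x = p i x := fun i x => by simp [ρ]
  -- Every `g` that oscillates by at most `ε` on the cover is approximated; this is used for `f`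
  -- itself and for `‖f‖`.
  have key : ∀ (g : C(X, ℂ)), (∀ i x, ‖f x - f i‖ < ε → ‖g x - g i‖ ≤ ε) →
      ∀ x, ‖g x - ∑ i ∈ t, g i * ρ i x‖ ≤ ε := by
    intro g hg x
    have hsum : ∑ i : t, p i x = 1 := by
      rw [← finsum_eq_sum_of_fintype]; exact p.sum_eq_one (Set.mem_univ x)
    rw [← Finset.sum_coe_sort t (fun i => g i * ρ i x)]
    have : g x - ∑ i : t, g i * ρ i x = ∑ i : t, (p i x : ℂ) * (g x - g i) := by
      simp only [mul_sub, Finset.sum_sub_distrib, ← Finset.sum_mul, hρ]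
      rw [← Complex.ofReal_sum, hsum]
      simp [mul_comm]
    rw [this]
    calc _ ≤ ∑ i : t, p i x * ε := norm_sum_le_of_le _ fun i _ => ?_
      _ = ε := by rw [← Finset.sum_mul, hsum, one_mul]
    rw [norm_mul, Complex.norm_real, Real.norm_of_nonneg (p.nonneg i x)]
    by_cases h0 : p i x = 0
    · simp [h0]
    · have hx : x ∈ U i := hp i (subset_tsupport _ h0)
      refine mul_le_mul_of_nonneg_left (hg i x ?_) (p.nonneg i x)
      simpa [U, dist_eq_norm] using hx
  refine ⟨t, ρ, f, fun i x => ?_, key f fun i x h => h.le, ?_⟩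
  · by_cases h : i ∈ t
    · simpa [ρ, h] using p.nonneg ⟨i, h⟩ x
    · simp [ρ, h]
  · refine key ⟨fun x => (‖f x‖ : ℂ), by fun_prop⟩ fun i x h => ?_
    simp only [ContinuousMap.coe_mk]
    rw [← Complex.ofReal_sub, Complex.norm_real]
    exact (abs_norm_sub_norm_le _ _).trans h.le

open scoped ComplexOrder in
theorem IsStarNormal.exists_nonneg_combination_approx {𝒜 : Type*} [CStarAlgebra 𝒜] [PartialOrder 𝒜]
    [StarOrderedRing 𝒜] {N : 𝒜} (hN : IsStarNormal N) {ε : ℝ} (hε : 0 < ε) :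
    ∃ (t : Finset (spectrum ℂ N)) (P : spectrum ℂ N → 𝒜) (c : spectrum ℂ N → ℂ),
      (∀ i, 0 ≤ P i) ∧ ‖N - ∑ i ∈ t, c i • P i‖ ≤ ε ∧
      ‖CFC.abs N - ∑ i ∈ t, (‖c i‖ : ℂ) • P i‖ ≤ ε := by
  obtain ⟨t, ρ, c, h0, h1, h2⟩ := _root_.exists_nonneg_combination_approx
    ((ContinuousMap.id ℂ).restrict (spectrum ℂ N)) hε
  have hid : N = cfcHom hN ((ContinuousMap.id ℂ).restrict (spectrum ℂ N)) := (cfcHom_id hN).symm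
  have habs : CFC.abs N = cfcHom hN ⟨fun x : spectrum ℂ N => (‖(x : ℂ)‖ : ℂ), by fun_prop⟩ := by
    rw [CFC.abs_eq_cfcₙ_coe_norm ℂ N hN, cfcₙ_eq_cfc]
    exact cfc_apply _ N hN (RCLike.continuous_ofReal.comp continuous_norm).continuousOn
  have hbound : ∀ (a : 𝒜) (g : C(spectrum ℂ N, ℂ)) (d : spectrum ℂ N → ℂ), a = cfcHom hN g →
      (∀ x, ‖g x - ∑ i ∈ t, d i * ρ i x‖ ≤ ε) → ‖a - ∑ i ∈ t, d i • cfcHom hN (ρ i)‖ ≤ ε := by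
    intro a g d ha hg
    rw [ha]
    simp only [← map_smul, ← map_sum, ← map_sub]
    rw [norm_cfcHom N _ hN, ContinuousMap.norm_le _ hε.le]
    intro x
    simpa using hg x
  exact ⟨t, fun i => cfcHom hN (ρ i), c, fun i => (cfcHom_nonneg_iff hN).2 (h0 i),
    hbound _ _ _ hid h1, hbound _ _ _ habs h2⟩

end Partition

/-! ### Positive maps at a normal element -/

section Positive

variable {𝒜 : Type*} [CStarAlgebra 𝒜] [PartialOrder 𝒜] [StarOrderedRing 𝒜]
variable {H : Type*} [NormedAddCommGroup H] [InnerProductSpace ℂ H]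

/-- The phase of `c` is absorbed into `x`, which does not change `⟪P x, x⟫`. -/
theorem two_mul_re_inner_smul_le_of_nonneg {P : H →L[ℂ] H} (hP : 0 ≤ P) (c : ℂ) (x y : H) :
    2 * (inner ℂ ((c • P) x) y).re ≤
      (inner ℂ (((‖c‖ : ℂ) • P) x) x).re + (inner ℂ (((‖c‖ : ℂ) • P) y) y).re := by
  obtain ⟨u, hu, hc⟩ : ∃ u : ℂ, ‖u‖ = 1 ∧ c = ‖c‖ * u :=
    ⟨Complex.exp (c.arg * Complex.I), by simp, by simp⟩
  have h := two_mul_re_inner_le_of_nonneg hP (u • x) y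
  have h1 : (inner ℂ (P (u • x)) (u • x)).re = (inner ℂ (P x) x).re := by
    rw [map_smul, inner_smul_left, inner_smul_right, ← mul_assoc, Complex.conj_mul', hu]
    simp
  rw [h1] at h
  have h2 : inner ℂ ((c • P) x) y = (‖c‖ : ℂ) * inner ℂ (P (u • x)) y := by
    nth_rewrite 1 [hc]
    simp only [smul_apply, map_smul, inner_smul_left, map_mul,
      Complex.conj_ofReal, mul_assoc]
  have h3 : ∀ z, inner ℂ (((‖c‖ : ℂ) • P) z) z = (‖c‖ : ℂ) * inner ℂ (P z) z := by
    intro z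
    simp
  rw [h2, h3, h3, Complex.re_ofReal_mul, Complex.re_ofReal_mul, Complex.re_ofReal_mul]
  nlinarith [norm_nonneg c]

variable [CompleteSpace H]

/-- Positivity of the operator matrix with rows `(Φ |N|, (Φ N)*)` and `(Φ N, Φ |N|)`. The pairs
`(∑ cᵢ Pᵢ, ∑ |cᵢ| Pᵢ)` with `Pᵢ ≥ 0` satisfy the inequality, and `(N, |N|)` is in their closure. -/
theorem PositiveLinearMap.two_mul_re_inner_le_of_isStarNormal (Φ : 𝒜 →ₚ[ℂ] (H →L[ℂ] H)) {N : 𝒜}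
    (hN : IsStarNormal N) (x y : H) :
    2 * (inner ℂ (Φ N x) y).re ≤
      (inner ℂ (Φ (CFC.abs N) x) x).re + (inner ℂ (Φ (CFC.abs N) y) y).re := by
  have hΦ : Continuous Φ := map_continuous Φ
  let S : Set (𝒜 × 𝒜) := {p | 2 * (inner ℂ (Φ p.1 x) y).re ≤
    (inner ℂ (Φ p.2 x) x).re + (inner ℂ (Φ p.2 y) y).re}
  have hcont : ∀ u v : H, Continuous fun a : 𝒜 => (inner ℂ (Φ a u) v).re := fun u v =>
    Complex.continuous_re.comp ((hΦ.clm_apply continuous_const).inner continuous_const)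
  have hS : IsClosed S :=
    isClosed_le (continuous_const.mul ((hcont x y).comp continuous_fst))
      (((hcont x x).comp continuous_snd).add ((hcont y y).comp continuous_snd))
  suffices (N, CFC.abs N) ∈ closure S from hS.closure_subset this
  refine Metric.mem_closure_iff.2 fun ε hε => ?_
  obtain ⟨t, P, c, hP, h1, h2⟩ := hN.exists_nonneg_combination_approx (half_pos hε)
  refine ⟨(∑ i ∈ t, c i • P i, ∑ i ∈ t, (‖c i‖ : ℂ) • P i), ?_, ?_⟩
  · have := Finset.sum_le_sum fun i (_ : i ∈ t) =>
      two_mul_re_inner_smul_le_of_nonneg (Φ.map_nonneg (hP i)) (c i) x y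
    simpa only [S, Set.mem_ofPred_eq, map_sum, map_smul, sum_apply, sum_inner,
      Complex.re_sum, Finset.mul_sum, Finset.sum_add_distrib] using this
  · rw [Prod.dist_eq, max_lt_iff, dist_eq_norm, dist_eq_norm]
    exact ⟨h1.trans_lt (half_lt_self hε), h2.trans_lt (half_lt_self hε)⟩

end Positive

/-! ### The polar decomposition -/

section Polar

variable {H : Type*} [NormedAddCommGroup H] [InnerProductSpace ℂ H] [CompleteSpace H]

theorem norm_cfcAbs_apply (T : H →L[ℂ] H) (x : H) : ‖CFC.abs T x‖ = ‖T x‖ := by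
  have h0 := (CFC.abs_nonneg T).isSelfAdjoint
  have h : inner ℂ (CFC.abs T x) (CFC.abs T x) = inner ℂ (T x) (T x) := by
    rw [← ContinuousLinearMap.adjoint_inner_left, ← ContinuousLinearMap.adjoint_inner_left,
      ← ContinuousLinearMap.star_eq_adjoint, h0.star_eq, ← ContinuousLinearMap.star_eq_adjoint,
      ← mul_apply_eq_comp, CFC.abs_mul_abs]
    rfl
  rw [@norm_eq_sqrt_re_inner ℂ, h, ← norm_eq_sqrt_re_inner]

/-- The polar decomposition, in adjoint form: `T x ↦ |T| x` is isometric on the range of `T`; `V` is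
its extension to the closure of the range, and `0` on the orthogonal complement. -/
theorem exists_isPartialIsometry_mul_eq_abs (T : H →L[ℂ] H) :
    ∃ V : H →L[ℂ] H, IsPartialIsometry V ∧ V * T = CFC.abs T := by
  let K : Submodule ℂ H := (LinearMap.range (T : H →ₗ[ℂ] H)).topologicalClosure
  have hKc : IsClosed (K : Set H) := Submodule.isClosed_topologicalClosure _
  have : CompleteSpace K := hKc.completeSpace_coe
  let e : H →ₗ[ℂ] K := (T : H →ₗ[ℂ] H).codRestrict K fun x =>
    Submodule.le_topologicalClosure _ (LinearMap.mem_range_self (T : H →ₗ[ℂ] H) x)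
  have he : DenseRange e := by
    intro k
    rw [closure_subtype, ← Set.range_comp]
    exact k.2
  have hn : ∀ x, ‖((CFC.abs T : H →L[ℂ] H) : H →ₗ[ℂ] H) x‖ ≤ 1 * ‖e x‖ := fun x => by
    rw [one_mul]; exact (norm_cfcAbs_apply T x).le
  let W : K →L[ℂ] H := ((CFC.abs T : H →L[ℂ] H) : H →ₗ[ℂ] H).extendOfNorm e
  have hW : ∀ x, W (e x) = CFC.abs T x := fun x => LinearMap.extendOfNorm_eq he ⟨1, hn⟩ x
  have hWn : ∀ k, ‖W k‖ = ‖k‖ := fun k =>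
    he.induction_on (p := fun k => ‖W k‖ = ‖k‖) k
      (isClosed_eq W.continuous.norm continuous_norm) fun x => by
        rw [hW, norm_cfcAbs_apply]; rfl
  refine ⟨W ∘L K.orthogonalProjectionOnto, fun x hx => ?_, ?_⟩
  · have hker : Kᗮ ≤ LinearMap.ker ((W ∘L K.orthogonalProjectionOnto : H →L[ℂ] H) : H →ₗ[ℂ] H) := by
      intro z hz
      simp [Submodule.orthogonalProjectionOnto_eq_zero_iff.2 hz]
    have hxK : x ∈ K := by
      rw [← K.orthogonal_orthogonal]
      exact Submodule.orthogonal_le hker hx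
    have : K.orthogonalProjectionOnto x = ⟨x, hxK⟩ :=
      Submodule.orthogonalProjectionOnto_mem_subspace_eq_self (⟨x, hxK⟩ : K)
    simp only [ContinuousLinearMap.comp_apply, this, hWn]
    rfl
  · ext x
    have : K.orthogonalProjectionOnto (T x) = e x :=
      Submodule.orthogonalProjectionOnto_mem_subspace_eq_self (e x)
    rw [mul_apply_eq_comp, ContinuousLinearMap.comp_apply, this, hW]

end Polar

/-! ### The inequality -/

theorem theorem2p1
    {𝒜 : Type*} [CStarAlgebra 𝒜] [PartialOrder 𝒜] [StarOrderedRing 𝒜]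
    {H : Type*} [NormedAddCommGroup H] [InnerProductSpace ℂ H] [CompleteSpace H]
    (Φ : 𝒜 →ₚ[ℂ] (H →L[ℂ] H)) (N : 𝒜) (hN : IsStarNormal N) :
    ∃ V : H →L[ℂ] H, IsPartialIsometry V ∧
      ∃ G : H →L[ℂ] H, IsGeomMean (Φ (CFC.abs N)) (V * Φ (CFC.abs N) * star V) G ∧
        CFC.abs (Φ N) ≤ G := by
  obtain ⟨V, hV, hVT⟩ := exists_isPartialIsometry_mul_eq_abs (Φ N)
  have hA : 0 ≤ Φ (CFC.abs N) := Φ.map_nonneg (CFC.abs_nonneg N)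
  have hB : 0 ≤ V * Φ (CFC.abs N) * star V := star_right_conjugate_nonneg hA V
  obtain ⟨G, hG⟩ := exists_isGeomMean hA hB
  refine ⟨V, hV, G, hG, hG.le_of_forall_re_inner_le hA hB (CFC.abs_nonneg _).isSelfAdjoint
    fun x y => ?_⟩
  have h := Φ.two_mul_re_inner_le_of_isStarNormal hN x (star V y)
  rw [← hVT]
  simpa only [mul_apply_eq_comp, ContinuousLinearMap.star_eq_adjoint,
    ContinuousLinearMap.adjoint_inner_right] using h
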